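/- Let $n\ge 2$ be a power of two and let $F\in\mathbb R^{n\times n}$ be the (normalized) Walsh–Hadamard matrix, $F(p,q)=n^{-1/2}(-1)^{\langle [p],[q]\rangle}$ for $0\le p,q<n$, where $[p]\in\{0,1\}^{\log_2 n}$ is the binary representation of $p$ and $\langle\cdot,\cdot\rangle$ is the dot product. An in-place algorithm with $m$ steps is a sequence of $m$ gates acting on vectors in $\mathbb R^n$. Each gate is either a rotation, which for two distinct indices $i,j$ and an angle $\theta$ replaces $(x_i,x_j)$ by $(\cos\theta\,x_i+\sin\theta\,x_j,\ -\sin\theta\,x_i+\cos\theta\,x_j)$, or a constant gate, which multiplies one coordinate by a nonzero real constant. Let $M^{(0)}=\mathrm{Id}$ and let $M^{(t)}$ be the matrix of the composition of the first $t$ gates; the algorithm computes $F$ if $M^{(m)}=F$. There are absolute constants $c_1,c_2>0$ such that the following holds for every such $n$, every real $b\ge 1$ and every in-place algorithm that computes $F$ in $m=(n\log_2 n)/b$ steps. At least one of the following two cases occurs. (i) (Severe overflow) There are an integer $n'\ge c_1 n$, orthonormal vectors $v_1,\dots,v_{n'}\in\mathbb R^n$, steps $t_1,\dots,t_{n'}\in\{1,\dots,m\}$,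 indices $i_1,\dots,i_{n'}$ and real numbers $\alpha_1,\dots,\alpha_{n'}\ge c_2\sqrt b$ such that for every $j$ the $i_j$-th row of $M^{(t_j)}$, projected orthogonally onto the orthogonal complement of $\operatorname{span}(v_1,\dots,v_{j-1})$, equals $\alpha_j v_j$. (ii) (Severe underflow) The same holds with the rows of $(M^{(t_j)})^{-T}=((M^{(t_j)})^{-1})^{T}$ in place of the rows of $M^{(t_j)}$. Moreover, in either case these can be chosen such that for every $j$ the $t_j$-th gate is a rotation and $i_j$ is one of the two indices it acts on, and such that the set $\{t_1,\dots,t_{n'}\}$ has at least $n'/2$ elements. -/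

import Mathlib

noncomputable section

/-- The Walsh-Hadamard matrix of order `n` (meant for `n` a power of two), rows and columns being
indexed by `0, …, n - 1`: its `(p, q)` entry is `(-1) ^ ⟨[p], [q]⟩ / √n`, where `⟨[p], [q]⟩` is the
dot product of the vectors of the `log₂ n` bits of `p` and `q`, that is, the number of bit
positions at which both `p` and `q` have a one. -/
def walshHadamard (n : ℕ) : Matrix (Fin n) (Fin n) ℝ :=
  Matrix.of fun p q =>
    (1 / √(n : ℝ)) *
      (-1) ^ ((Finset.range (Nat.log 2 n)).filter
        fun r => (p : ℕ).testBit r = true ∧ (q : ℕ).testBit r = true).card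

/-- A gate of the in-place model on `n` machine words: a rotation by the angle `θ` acting on two
distinct coordinates, or the multiplication of one coordinate by a nonzero constant. -/
inductive Gate (n : ℕ) : Type
  | rotation (i j : Fin n) (hij : i ≠ j) (θ : ℝ) : Gate n
  | constant (i : Fin n) (a : ℝ) (ha : a ≠ 0) : Gate n

/-- The matrix of a gate: the identity matrix except in the rows of the affected coordinates.
A rotation replaces `(x i, x j)` by `(cos θ * x i + sin θ * x j, -sin θ * x i + cos θ * x j)`; a
constant gate replaces `x i` by `a * x i`. -/
def Gate.matrix {n : ℕ} : Gate n → Matrix (Fin n) (Fin n) ℝ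
  | .rotation i j _ θ =>
      ((1 : Matrix (Fin n) (Fin n) ℝ).updateRow i
          (Pi.single i (Real.cos θ) + Pi.single j (Real.sin θ))).updateRow j
        (Pi.single i (-Real.sin θ) + Pi.single j (Real.cos θ))
  | .constant i a _ => (1 : Matrix (Fin n) (Fin n) ℝ).updateRow i (Pi.single i a)

/-- The gate is a rotation, and `p` is one of the two coordinates it affects. -/
def Gate.IsRotationOn {n : ℕ} : Gate n → Fin n → Prop
  | .rotation i j _ _, p => p = i ∨ p = j
  | .constant _ _ _, _ => False

/-- An in-place algorithm with `m` steps on `n` words is a sequence of `m` gates.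
`stateMatrix g t` is the matrix mapping the input to the machine state after the first `t` steps:
`stateMatrix g 0 = 1`, and `stateMatrix g t.succ = (g t).matrix * stateMatrix g t.castSucc`. -/
def stateMatrix {n m : ℕ} (g : Fin m → Gate n) : Fin (m + 1) → Matrix (Fin n) (Fin n) ℝ :=
  Fin.induction 1 fun t M => (g t).matrix * M

/-- The orthogonal projection of `x` onto the space orthogonal to the vectors `v l` with `l < j`. -/
def projAwayFromPrevious {n n' : ℕ} (v : Fin n' → EuclideanSpace ℝ (Fin n)) (j : Fin n')
    (x : EuclideanSpace ℝ (Fin n)) : EuclideanSpace ℝ (Fin n) :=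
  (Submodule.span ℝ (v '' {l | l < j}))ᗮ.starProjection x

/-- There are at least `c₁ * n` orthonormal vectors `v j`, steps `t j` and indices `i j` such that
row `i j` of the matrix `N (t j)`, projected away from the previous `v l`, is `α j • v j` with
`α j ≥ c₂ * √b`. Each gate `t j` is a rotation affecting `i j`, and at least half as many different
steps occur as there are vectors. -/
def HasSevereDirections {n m : ℕ} (g : Fin m → Gate n) (N : Fin m → Matrix (Fin n) (Fin n) ℝ)
    (c₁ c₂ b : ℝ) : Prop :=
  ∃ n' : ℕ, c₁ * (n : ℝ) ≤ (n' : ℝ) ∧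
    ∃ (v : Fin n' → EuclideanSpace ℝ (Fin n)) (t : Fin n' → Fin m) (i : Fin n' → Fin n)
      (α : Fin n' → ℝ),
      Orthonormal ℝ v ∧
      (∀ j, projAwayFromPrevious v j (WithLp.toLp 2 ((N (t j)).row (i j))) = α j • v j ∧
        c₂ * √b ≤ α j) ∧
      (∀ j, (g (t j)).IsRotationOn (i j)) ∧
      (n' : ℝ) / 2 ≤ ((Finset.univ.image t).card : ℝ)

/-- Severe overflow: the directions come from rows of the matrices after the steps `t j`. -/
def SevereOverflow {n m : ℕ} (g : Fin m → Gate n) (c₁ c₂ b : ℝ) : Prop :=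
  HasSevereDirections g (fun t => stateMatrix g t.succ) c₁ c₂ b

/-- Severe underflow: the directions come from rows of the transposed inverses of the matrices
after the steps `t j`. -/
def SevereUnderflow {n m : ℕ} (g : Fin m → Gate n) (c₁ c₂ b : ℝ) : Prop :=
  HasSevereDirections g (fun t => ((stateMatrix g t.succ)⁻¹).transpose) c₁ c₂ b

end

open Finset

/-! ### Scalar inequalities for the odd function -x log|x|. -/

section Entropy

/-! The proof is an entropy potential argument. For the state M, consider the sum of -z log|z| over
the entrywise products z of M and its transposed inverse. Constant gates leave every product
unchanged. A rotation changes the potential by at most a multiple of the squared lengths of the rows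
it touches (`negMulLog_pair_sub_le`, `productEntropy_act_le`). The potential is 0 at the identity
and n log n at the Walsh-Hadamard matrix, so (n log n)/b steps require some rows of squared length
of order b.

To get linearly many independent long rows, collect directions greedily: as long as some touched row
has a long component orthogonal to the directions found so far, normalize that component and add it.
If this stops early for both M and its transposed inverse, the spans S and T have dimension at most
c₁n, and every touched row is short after projection to the complement of S, respectively T
(`hasSevereDirections_or_exists_submodule`).

Row operations commute with these projections, so the potential of the projected rows still grows
slowly (`productEntropy_stateMatrix_le`). Since S and T are small, projecting perturbs the products
little in total absolute value, and the gap between the two ends remains at least (n log n)/2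
(`productEntropy_walsh_gap`). These two bounds contradict each other. -/

theorem negMulLog_neg (x : ℝ) : Real.negMulLog (-x) = -Real.negMulLog x := by
  simp [Real.negMulLog, Real.log_neg_eq_log]

theorem abs_negMulLog_le_one {x : ℝ} (hx : |x| ≤ 1) : |Real.negMulLog x| ≤ 1 := by
  have key : ∀ y : ℝ, 0 ≤ y → y ≤ 1 → |Real.negMulLog y| ≤ 1 := by
    intro y h0 h1
    rcases h0.eq_or_lt with rfl | h0
    · simp
    · have := Real.abs_log_mul_self_lt y h0 h1
      rw [Real.negMulLog, neg_mul, abs_neg, mul_comm]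
      exact this.le
  rw [abs_le] at hx
  rcases le_total 0 x with h | h
  · exact key x h hx.2
  · have := key (-x) (by linarith) (by linarith)
    rwa [negMulLog_neg, abs_neg] at this

/-- Two products of entries of planar vectors, with prescribed lengths of the vectors and prescribed
sum of the products, have an entropy that varies by at most a multiple of the squared lengths. -/
theorem negMulLog_pair_sub_le {a b c d a' b' c' d' : ℝ} (h₁ : a ^ 2 + b ^ 2 = a' ^ 2 + b' ^ 2)
    (h₂ : c ^ 2 + d ^ 2 = c' ^ 2 + d' ^ 2) (h : a * c + b * d = a' * c' + b' * d') :
    Real.negMulLog (a' * c') + Real.negMulLog (b' * d')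
      - (Real.negMulLog (a * c) + Real.negMulLog (b * d))
      ≤ 2 * ((a' ^ 2 + b' ^ 2) + (c' ^ 2 + d' ^ 2)) := by
  set r := √(a' ^ 2 + b' ^ 2) with hr
  set s := √(c' ^ 2 + d' ^ 2) with hs
  have hr2 : r ^ 2 = a' ^ 2 + b' ^ 2 := Real.sq_sqrt (by positivity)
  have hs2 : s ^ 2 = c' ^ 2 + d' ^ 2 := Real.sq_sqrt (by positivity)
  have hr0 : 0 ≤ r := Real.sqrt_nonneg _
  have hs0 : 0 ≤ s := Real.sqrt_nonneg _
  have prod_le : ∀ x y : ℝ, x ^ 2 ≤ r ^ 2 → y ^ 2 ≤ s ^ 2 → |x * y| ≤ r * s := by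
    intro x y hx hy
    rw [abs_mul]
    exact mul_le_mul (abs_le_of_sq_le_sq hx hr0)
      (abs_le_of_sq_le_sq hy hs0) (abs_nonneg _) hr0
  have e1 := prod_le a c (by nlinarith [sq_nonneg b]) (by nlinarith [sq_nonneg d])
  have e2 := prod_le b d (by nlinarith [sq_nonneg a]) (by nlinarith [sq_nonneg c])
  have e3 := prod_le a' c' (by nlinarith [sq_nonneg b']) (by nlinarith [sq_nonneg d'])
  have e4 := prod_le b' d' (by nlinarith [sq_nonneg a']) (by nlinarith [sq_nonneg c'])
  have hrs : 4 * (r * s) ≤ 2 * ((a' ^ 2 + b' ^ 2) + (c' ^ 2 + d' ^ 2)) := by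
    nlinarith [sq_nonneg (r - s)]
  refine le_trans ?_ hrs
  rcases (mul_nonneg hr0 hs0).eq_or_lt with h0 | h0
  · rw [← h0] at e1 e2 e3 e4
    rw [abs_nonpos_iff] at e1 e2 e3 e4
    simp [e1, e2, e3, e4, ← h0]
  -- Divide every product by r * s. As H(λz) = λ H(z) + z H(λ) for H(x) = -x log|x|, each entropy is
  -- a term linear in the product plus an error of size at most r * s. The linear terms cancel
  -- because both pairs have the same sum.
  · have scale : ∀ x : ℝ, |x| ≤ r * s →
        |Real.negMulLog x - x / (r * s) * Real.negMulLog (r * s)| ≤ r * s := by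
      intro x hx
      have h1 : x = (r * s) * (x / (r * s)) := (mul_div_cancel₀ x h0.ne').symm
      have h2 : Real.negMulLog x - x / (r * s) * Real.negMulLog (r * s)
          = (r * s) * Real.negMulLog (x / (r * s)) := by
        conv_lhs => rw [h1, Real.negMulLog_mul, ← h1]
        ring
      rw [h2, abs_mul, abs_of_pos h0]
      refine mul_le_of_le_one_right h0.le (abs_negMulLog_le_one ?_)
      rw [abs_div, abs_of_pos h0]
      exact (div_le_one h0).2 hx
    have f1 := (abs_le.1 (scale _ e1)).1
    have f2 := (abs_le.1 (scale _ e2)).1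
    have f3 := (abs_le.1 (scale _ e3)).2
    have f4 := (abs_le.1 (scale _ e4)).2
    have hsum : a * c / (r * s) * Real.negMulLog (r * s) + b * d / (r * s) * Real.negMulLog (r * s)
        = a' * c' / (r * s) * Real.negMulLog (r * s)
          + b' * d' / (r * s) * Real.negMulLog (r * s) := by
      rw [← add_mul, ← add_mul, ← add_div, ← add_div, h]
    linarith

theorem negMulLog_nonpos_of_neg {x : ℝ} (h : x ≤ 0) (h1 : -1 ≤ x) : Real.negMulLog x ≤ 0 := by
  have := Real.negMulLog_nonneg (x := -x) (by linarith) (by linarith)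
  rw [negMulLog_neg] at this
  linarith

/-- Linearizes the entropy near 0, where its slope is infinite: the additive error 1 / l is
affordable even when summed over all n² entries. -/
theorem negMulLog_le_abs_mul_log {x l : ℝ} (hx : -1 ≤ x) (hl : 0 < l) (hlog : 1 ≤ Real.log l) :
    Real.negMulLog x ≤ |x| * Real.log l + 1 / l := by
  rcases le_or_gt x 0 with h | hy
  · exact (negMulLog_nonpos_of_neg h hx).trans (by positivity)
  · have := Real.log_le_sub_one_of_pos (x := 1 / (l * x)) (by positivity)
    rw [one_div, Real.log_inv, Real.log_mul hl.ne' hy.ne'] at this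
    have h2 := mul_le_mul_of_nonneg_left this hy.le
    have h3 : x * ((l * x)⁻¹ - 1) = 1 / l - x := by field_simp
    rw [h3] at h2
    rw [Real.negMulLog, abs_of_pos hy]
    linarith

theorem negMulLog_le_abs_sub_one_mul_log {x l : ℝ} (hx : -1 ≤ x) (hl : 0 < l)
    (hlog : 1 ≤ Real.log l) :
    Real.negMulLog x ≤ |x - 1| * Real.log l + 1 / l := by
  have hl' : 0 ≤ 1 / l := by positivity
  rcases le_or_gt x 0 with h | hy
  · exact (negMulLog_nonpos_of_neg h hx).trans (by positivity)
  · have h1 := Real.log_le_sub_one_of_pos (x := x⁻¹) (by positivity)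
    rw [Real.log_inv] at h1
    have h2 := mul_le_mul_of_nonneg_left h1 hy.le
    have h3 : x * (x⁻¹ - 1) = 1 - x := by field_simp
    have h4 : 1 - x ≤ |x - 1| := by rw [abs_sub_comm]; exact le_abs_self _
    have h5 := le_mul_of_one_le_right (abs_nonneg (x - 1)) hlog
    rw [Real.negMulLog]
    linarith

theorem mul_log_le_abs_sub_one_mul {z N : ℝ} (hN : 1 ≤ N) (hz : |z| ≤ N) :
    z * Real.log z ≤ |z - 1| * (Real.log N + 1) := by
  have hlN := Real.log_nonneg hN
  rcases le_or_gt 1 z with h1 | h1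
  · have a1 := Real.log_le_sub_one_of_pos (x := z) (by linarith)
    have a2 : Real.log z ≤ Real.log N := Real.log_le_log (by linarith) ((le_abs_self z).trans hz)
    rw [abs_of_nonneg (by linarith : 0 ≤ z - 1)]
    nlinarith
  · have hpos : 0 ≤ |z - 1| * (Real.log N + 1) := by positivity
    rcases le_or_gt 0 z with h0 | h0
    · exact (Real.mul_log_nonpos h0 h1.le).trans hpos
    · rcases le_or_gt (-1) z with hz1 | hz1
      · have a1 := (abs_le.1 (abs_negMulLog_le_one (x := z) (abs_le.2 ⟨hz1, h1.le⟩))).1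
        rw [Real.negMulLog] at a1
        rw [abs_of_neg (by linarith : z - 1 < 0)]
        nlinarith
      · have := Real.log_nonneg (x := -z) (by linarith)
        rw [Real.log_neg_eq_log] at this
        nlinarith

end Entropy

/-! ### Orthogonality and flatness of the Walsh-Hadamard matrix. -/

section Walsh

theorem walshHadamard_row_inner {k : ℕ} (p p' : Fin (2 ^ k)) :
    ∑ q, walshHadamard (2 ^ k) p q * walshHadamard (2 ^ k) p' q = if p = p' then 1 else 0 := by
  have hn : (0 : ℝ) < ((2 ^ k : ℕ) : ℝ) := by positivity
  have hs : 1 / √((2 ^ k : ℕ) : ℝ) * (1 / √((2 ^ k : ℕ) : ℝ)) = 1 / ((2 ^ k : ℕ) : ℝ) := by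
    rw [div_mul_div_comm, Real.mul_self_sqrt hn.le, one_mul]
  split_ifs with h
  · subst h
    have : ∀ q, walshHadamard (2 ^ k) p q * walshHadamard (2 ^ k) p q
        = 1 / ((2 ^ k : ℕ) : ℝ) := by
      intro q
      rw [walshHadamard, Matrix.of_apply, mul_mul_mul_comm, hs, ← mul_pow]
      simp
    rw [sum_congr rfl fun q _ => this q, sum_const, card_univ, Fintype.card_fin, nsmul_eq_mul]
    exact mul_one_div_cancel hn.ne'
  · obtain ⟨r, hr⟩ : ∃ r, (p : ℕ).testBit r ≠ (p' : ℕ).testBit r := by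
      by_contra! hc
      exact h (Fin.ext (Nat.eq_of_testBit_eq hc))
    have hrk : r < k := by
      by_contra! hc
      have hle := Nat.pow_le_pow_right (n := 2) (by norm_num) hc
      exact hr (by rw [Nat.testBit_lt_two_pow (p.2.trans_le hle),
        Nat.testBit_lt_two_pow (p'.2.trans_le hle)])
    have entry : ∀ p q : Fin (2 ^ k), walshHadamard (2 ^ k) p q = 1 / √((2 ^ k : ℕ) : ℝ) *
        ∏ s ∈ range k, if (p : ℕ).testBit s = true ∧ (q : ℕ).testBit s = true
          then (-1 : ℝ) else 1 := by
      intro p q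
      rw [walshHadamard, Matrix.of_apply, Nat.log_pow (by norm_num), prod_ite, prod_const,
        prod_const_one, mul_one]
    have hlt : ∀ q : Fin (2 ^ k), (q : ℕ) ^^^ 2 ^ r < 2 ^ k := fun q =>
      Nat.xor_lt_two_pow q.2 (Nat.pow_lt_pow_right (by norm_num) hrk)
    have hbit : ∀ (q : Fin (2 ^ k)) s, ((q : ℕ) ^^^ 2 ^ r).testBit s
        = ((q : ℕ).testBit s ^^ decide (r = s)) := by
      intro q s
      rw [Nat.testBit_xor, Nat.testBit_two_pow]
    have flip : ∀ p q : Fin (2 ^ k), walshHadamard (2 ^ k) p ⟨(q : ℕ) ^^^ 2 ^ r, hlt q⟩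
        = (if (p : ℕ).testBit r then -1 else 1) * walshHadamard (2 ^ k) p q := by
      intro p q
      rw [entry, entry, ← mul_prod_erase _ _ (mem_range.2 hrk),
        ← mul_prod_erase (range k) (fun s => if (p : ℕ).testBit s = true ∧
          (q : ℕ).testBit s = true then (-1 : ℝ) else 1) (mem_range.2 hrk)]
      have : ∏ s ∈ (range k).erase r, (if (p : ℕ).testBit s = true ∧
            ((q : ℕ) ^^^ 2 ^ r).testBit s = true then (-1 : ℝ) else 1)
          = ∏ s ∈ (range k).erase r, (if (p : ℕ).testBit s = true ∧
            (q : ℕ).testBit s = true then (-1 : ℝ) else 1) := by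
        refine prod_congr rfl fun s hs => ?_
        rw [hbit, decide_eq_false (ne_of_mem_erase hs).symm, Bool.xor_false]
      simp only [this]
      rw [hbit]
      cases (p : ℕ).testBit r <;> cases (q : ℕ).testBit r <;> simp
    -- Flipping bit r of q, a bit at which p and p' differ, changes the sign of exactly one of the
    -- two factors, so the terms cancel in pairs.
    refine sum_involution (fun q _ => ⟨(q : ℕ) ^^^ 2 ^ r, hlt q⟩) ?_ ?_ (fun _ _ => mem_univ _) ?_
    · intro q _
      rw [flip, flip]
      cases h1 : (p : ℕ).testBit r <;> cases h2 : (p' : ℕ).testBit r <;> simp_all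
    · intro q _ _ hq
      have := congrArg (fun x : Fin (2 ^ k) => (x : ℕ).testBit r) hq
      simp only [hbit] at this
      simp at this
    · intro q _
      ext
      simp

theorem walshHadamard_mul_transpose (k : ℕ) :
    walshHadamard (2 ^ k) * (walshHadamard (2 ^ k)).transpose = 1 := by
  ext p p'
  rw [Matrix.mul_apply, Matrix.one_apply]
  exact walshHadamard_row_inner p p'

theorem walshHadamard_inv_transpose (k : ℕ) :
    ((walshHadamard (2 ^ k))⁻¹).transpose = walshHadamard (2 ^ k) := by
  rw [Matrix.inv_eq_right_inv (walshHadamard_mul_transpose k), Matrix.transpose_transpose]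

theorem walshHadamard_sq {n : ℕ} (p q : Fin n) : walshHadamard n p q ^ 2 = 1 / (n : ℝ) := by
  rw [walshHadamard, Matrix.of_apply, mul_pow, ← pow_mul, mul_comm _ 2, pow_mul, neg_one_sq,
    one_pow, mul_one, div_pow, one_pow, Real.sq_sqrt (Nat.cast_nonneg n)]

end Walsh

/-! ### Gates as linear operations on families of vectors, and their duals. -/

section Gates

variable {n m : ℕ} {E F : Type*} [AddCommGroup E] [Module ℝ E] [AddCommGroup F] [Module ℝ F]

/-- The action of a gate on a family of `n` vectors. -/
noncomputable def Gate.act : Gate n → (Fin n → E) → Fin n → E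
  | .rotation i j _ θ, x =>
      Function.update (Function.update x i (Real.cos θ • x i + Real.sin θ • x j)) j
        (-Real.sin θ • x i + Real.cos θ • x j)
  | .constant i a _, x => Function.update x i (a • x i)

/-- The gate whose matrix is the transposed inverse of the matrix of the given gate. -/
noncomputable def Gate.dual : Gate n → Gate n
  | .rotation i j hij θ => .rotation i j hij θ
  | .constant i a ha => .constant i a⁻¹ (inv_ne_zero ha)

/-- Gates form linear combinations of rows, so they commute with any linear map applied to each row;
this is used for orthogonal projections. -/
theorem Gate.map_act (L : E →ₗ[ℝ] F) (g : Gate n) (x : Fin n → E) (k : Fin n) :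
    L (g.act x k) = g.act (fun l => L (x l)) k := by
  cases g with
  | rotation i j hij θ =>
    by_cases hj : k = j
    · subst hj; simp [Gate.act]
    · by_cases hi : k = i
      · subst hi; simp [Gate.act, hj]
      · simp [Gate.act, hj, hi]
  | constant i a ha =>
    by_cases hi : k = i
    · subst hi; simp [Gate.act]
    · simp [Gate.act, hi]

theorem Gate.row_matrix_mul (g : Gate n) (M : Matrix (Fin n) (Fin n) ℝ) (k : Fin n) :
    (g.matrix * M).row k = g.act M.row k := by
  change (g.matrix * M) k = _
  rw [Matrix.mul_apply_eq_vecMul]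
  cases g with
  | rotation i j hij θ =>
    by_cases hj : k = j
    · subst hj
      simp [Gate.act, Gate.matrix, Matrix.add_vecMul, Matrix.single_vecMul]
    · by_cases hi : k = i
      · subst hi
        simp [Gate.act, Gate.matrix, hj, Matrix.add_vecMul, Matrix.single_vecMul]
      · rw [Gate.act, Gate.matrix, Matrix.updateRow_ne hj, Matrix.updateRow_ne hi,
          Function.update_of_ne hj, Function.update_of_ne hi, ← Matrix.mul_apply_eq_vecMul,
          one_mul]
        rfl
  | constant i a ha =>
    by_cases hi : k = i
    · subst hi
      simp [Gate.act, Gate.matrix, Matrix.single_vecMul]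
    · rw [Gate.act, Gate.matrix, Matrix.updateRow_ne hi,
        Function.update_of_ne hi, ← Matrix.mul_apply_eq_vecMul, one_mul]
      rfl

theorem Gate.matrix_mul_dual_transpose (g : Gate n) : g.matrix * g.dual.matrix.transpose = 1 := by
  ext k l
  change (g.matrix * g.dual.matrix.transpose).row k l = _
  rw [Gate.row_matrix_mul]
  cases g with
  | rotation i j hij θ =>
    have hcs := Real.cos_sq_add_sin_sq θ
    have hij' := hij.symm
    simp only [Gate.act, Gate.matrix, Gate.dual, Function.update_apply, Matrix.one_apply]
    split_ifs <;>
    simp only [Matrix.row_apply, Matrix.transpose_apply, Pi.add_apply, Pi.smul_apply,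
      Matrix.updateRow_apply, Matrix.one_apply, Pi.single_apply, smul_eq_mul] <;>
    grind
  | constant i a ha =>
    simp only [Gate.act, Gate.matrix, Gate.dual, Function.update_apply, Matrix.one_apply]
    split_ifs <;>
    simp only [Matrix.row_apply, Matrix.transpose_apply, Pi.smul_apply,
      Matrix.updateRow_apply, Matrix.one_apply, Pi.single_apply, smul_eq_mul] <;>
    grind

theorem Gate.matrix_inv_transpose (g : Gate n) : (g.matrix⁻¹).transpose = g.dual.matrix := by
  rw [Matrix.inv_eq_right_inv g.matrix_mul_dual_transpose, Matrix.transpose_transpose]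

theorem stateMatrix_zero (g : Fin m → Gate n) : stateMatrix g 0 = 1 := rfl

theorem stateMatrix_succ (g : Fin m → Gate n) (t : Fin m) :
    stateMatrix g t.succ = (g t).matrix * stateMatrix g t.castSucc := rfl

theorem stateMatrix_succ_inv_transpose (g : Fin m → Gate n) (t : Fin m) :
    ((stateMatrix g t.succ)⁻¹).transpose
      = (g t).dual.matrix * ((stateMatrix g t.castSucc)⁻¹).transpose := by
  rw [stateMatrix_succ, Matrix.mul_inv_rev, Matrix.transpose_mul, Gate.matrix_inv_transpose]

end Gates

/-! ### The potential and its growth under one gate. -/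

section Potential

variable {n : ℕ}

/-- The entropy of the entrywise products of two families of vectors. -/
noncomputable def productEntropy (x y : Fin n → EuclideanSpace ℝ (Fin n)) : ℝ :=
  ∑ i, ∑ k, Real.negMulLog (x i k * y i k)

theorem productEntropy_act_le (g : Gate n) (x y : Fin n → EuclideanSpace ℝ (Fin n)) {ρ : ℝ}
    (hx : ∀ p, g.IsRotationOn p → ‖g.act x p‖ ≤ ρ)
    (hy : ∀ p, g.IsRotationOn p → ‖g.dual.act y p‖ ≤ ρ) :
    productEntropy (g.act x) (g.dual.act y) ≤ productEntropy x y + 8 * ρ ^ 2 := by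
  cases g with
  | constant i a ha =>
    have : productEntropy ((Gate.constant i a ha).act x) ((Gate.constant i a ha).dual.act y)
        = productEntropy x y := by
      refine sum_congr rfl fun p _ => sum_congr rfl fun k _ => ?_
      congr 1
      by_cases hp : p = i
      · subst hp
        simp only [Gate.act, Gate.dual, Function.update_self, PiLp.smul_apply, smul_eq_mul]
        field_simp
      · simp [Gate.act, Gate.dual, hp]
    rw [this]
    have := sq_nonneg ρ
    linarith
  | rotation i j hij θ =>
    set x' := (Gate.rotation i j hij θ).act x with hx'
    set y' := (Gate.rotation i j hij θ).dual.act y with hy'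
    have hcs := Real.cos_sq_add_sin_sq θ
    have xi : ∀ k, x' i k = Real.cos θ * x i k + Real.sin θ * x j k := by
      intro k; simp [hx', Gate.act, hij]
    have xj : ∀ k, x' j k = -Real.sin θ * x i k + Real.cos θ * x j k := by
      intro k; simp [hx', Gate.act]
    have yi : ∀ k, y' i k = Real.cos θ * y i k + Real.sin θ * y j k := by
      intro k; simp [hy', Gate.act, Gate.dual, hij]
    have yj : ∀ k, y' j k = -Real.sin θ * y i k + Real.cos θ * y j k := by
      intro k; simp [hy', Gate.act, Gate.dual]
    have split : ∀ z w : Fin n → EuclideanSpace ℝ (Fin n), productEntropy z w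
        = ∑ k, (Real.negMulLog (z i k * w i k) + Real.negMulLog (z j k * w j k))
          + ∑ p ∈ (univ.erase i).erase j, ∑ k, Real.negMulLog (z p k * w p k) := by
      intro z w
      rw [productEntropy, ← add_sum_erase _ _ (mem_univ i),
        ← add_sum_erase (univ.erase i) _ (mem_erase.2 ⟨hij.symm, mem_univ j⟩), ← add_assoc,
        sum_add_distrib]
    have rest : ∑ p ∈ (univ.erase i).erase j, ∑ k, Real.negMulLog (x' p k * y' p k)
        = ∑ p ∈ (univ.erase i).erase j, ∑ k, Real.negMulLog (x p k * y p k) := by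
      refine sum_congr rfl fun p hp => ?_
      have hpj := ne_of_mem_erase hp
      have hpi := ne_of_mem_erase (mem_of_mem_erase hp)
      simp [hx', hy', Gate.act, Gate.dual, hpi, hpj]
    have pair : ∀ k, Real.negMulLog (x' i k * y' i k) + Real.negMulLog (x' j k * y' j k)
        ≤ Real.negMulLog (x i k * y i k) + Real.negMulLog (x j k * y j k)
          + 2 * ((x' i k ^ 2 + x' j k ^ 2) + (y' i k ^ 2 + y' j k ^ 2)) := by
      intro k
      -- Invariance of the planar inner product. It supplies all three conditions of
      -- `negMulLog_pair_sub_le`, applied to (x, x), (y, y) and (x, y).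
      have rot : ∀ u v z w : ℝ, u * z + v * w
          = (Real.cos θ * u + Real.sin θ * v) * (Real.cos θ * z + Real.sin θ * w)
            + (-Real.sin θ * u + Real.cos θ * v) * (-Real.sin θ * z + Real.cos θ * w) := by
        intro u v z w
        linear_combination (-(u * z + v * w)) * hcs
      have := negMulLog_pair_sub_le (a := x i k) (b := x j k) (c := y i k) (d := y j k)
        (a' := x' i k) (b' := x' j k) (c' := y' i k) (d' := y' j k)
        (by rw [xi, xj]; simpa only [pow_two] using rot (x i k) (x j k) (x i k) (x j k))
        (by rw [yi, yj]; simpa only [pow_two] using rot (y i k) (y j k) (y i k) (y j k))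
        (by rw [xi, xj, yi, yj]; exact rot _ _ _ _)
      linarith
    have norm_le : ∀ z : EuclideanSpace ℝ (Fin n), ‖z‖ ≤ ρ → ∑ k, z k ^ 2 ≤ ρ ^ 2 := by
      intro z hz
      rw [← EuclideanSpace.real_norm_sq_eq]
      exact pow_le_pow_left₀ (norm_nonneg _) hz 2
    have n1 := norm_le _ (hx i (Or.inl rfl))
    have n2 := norm_le _ (hx j (Or.inr rfl))
    have n3 := norm_le _ (hy i (Or.inl rfl))
    have n4 := norm_le _ (hy j (Or.inr rfl))
    have total := sum_le_sum fun k (_ : k ∈ univ) => pair k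
    rw [sum_add_distrib (f := fun k => Real.negMulLog (x i k * y i k)
      + Real.negMulLog (x j k * y j k)), ← mul_sum, sum_add_distrib (f := fun k => x' i k ^ 2
      + x' j k ^ 2), sum_add_distrib (f := fun k => x' i k ^ 2),
      sum_add_distrib (f := fun k => y' i k ^ 2)] at total
    rw [split, split x y, rest]
    linarith

end Potential

/-! ### Greedy selection of severe directions. -/

section Directions

variable {n m : ℕ}

/-- `v`, `t`, `i` and `α` are orthonormal vectors, steps, indices and coefficients as in
`HasSevereDirections`, with threshold `ρ` and without any condition on their number. -/
structure IsDirectionSystem (g : Fin m → Gate n) (N : Fin m → Matrix (Fin n) (Fin n) ℝ) (ρ : ℝ)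
    {n' : ℕ} (v : Fin n' → EuclideanSpace ℝ (Fin n)) (t : Fin n' → Fin m) (i : Fin n' → Fin n)
    (α : Fin n' → ℝ) : Prop where
  orthonormal : Orthonormal ℝ v
  proj_eq : ∀ j, projAwayFromPrevious v j (WithLp.toLp 2 ((N (t j)).row (i j))) = α j • v j
  le_coeff : ∀ j, ρ ≤ α j
  isRotationOn : ∀ j, (g (t j)).IsRotationOn (i j)

theorem projAwayFromPrevious_eq_zero {n' : ℕ} {v : Fin n' → EuclideanSpace ℝ (Fin n)}
    {j : Fin n'} {x : EuclideanSpace ℝ (Fin n)} (hx : x ∈ Submodule.span ℝ (v '' {l | l < j})) :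
    projAwayFromPrevious v j x = 0 :=
  Submodule.starProjection_orthogonal_apply_eq_zero hx

theorem mem_span_of_projAwayFromPrevious_eq {n' : ℕ} {v : Fin n' → EuclideanSpace ℝ (Fin n)}
    {j j' : Fin n'} (hj : j < j') {x : EuclideanSpace ℝ (Fin n)} {a : ℝ}
    (hx : projAwayFromPrevious v j x = a • v j) :
    x ∈ Submodule.span ℝ (v '' {l | l < j'}) := by
  rw [← Submodule.starProjection_add_starProjection_orthogonal
    (K := Submodule.span ℝ (v '' {l | l < j})) x]
  refine Submodule.add_mem _ (Submodule.span_mono (Set.image_mono fun l hl => lt_trans hl hj)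
    (Submodule.starProjection_apply_mem _ _)) ?_
  change projAwayFromPrevious v j x ∈ _
  rw [hx]
  exact Submodule.smul_mem _ _ (Submodule.subset_span ⟨j, hj, rfl⟩)

/-- A row that has been used lies in the span of the directions up to its own, so using it again
would leave a zero residual, against the positive threshold. -/
theorem IsDirectionSystem.eq_of_eq {g : Fin m → Gate n} {N : Fin m → Matrix (Fin n) (Fin n) ℝ}
    {ρ : ℝ} (hρ : 0 < ρ) {n' : ℕ} {v : Fin n' → EuclideanSpace ℝ (Fin n)} {t : Fin n' → Fin m}
    {i : Fin n' → Fin n} {α : Fin n' → ℝ} (h : IsDirectionSystem g N ρ v t i α) {j j' : Fin n'}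
    (ht : t j = t j') (hi : i j = i j') : j = j' := by
  have key : ∀ a b : Fin n', t a = t b → i a = i b → ¬ a < b := by
    intro a b hta hia hab
    have hb := h.proj_eq b
    rw [projAwayFromPrevious_eq_zero (mem_span_of_projAwayFromPrevious_eq hab
      (by rw [← hta, ← hia]; exact h.proj_eq a)), eq_comm, smul_eq_zero] at hb
    rcases hb with hb | hb
    · have := h.le_coeff b
      linarith
    · exact h.orthonormal.ne_zero b hb
  rcases lt_trichotomy j j' with hlt | heq | hgt
  · exact absurd hlt (key _ _ ht hi)
  · exact heq
  · exact absurd hgt (key _ _ ht.symm hi.symm)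

theorem Gate.isRotationOn_subset (g : Gate n) :
    ∃ s : Finset (Fin n), s.card ≤ 2 ∧ ∀ p, g.IsRotationOn p → p ∈ s := by
  cases g with
  | rotation i j hij θ =>
    refine ⟨{i, j}, card_le_two, fun p hp => ?_⟩
    rcases hp with rfl | rfl <;> simp
  | constant i a ha => exact ⟨∅, by simp, fun p hp => hp.elim⟩

/-- A rotation touches two rows and no row of a given step is used twice, so each step occurs at
most twice. -/
theorem IsDirectionSystem.half_le_card_image {g : Fin m → Gate n}
    {N : Fin m → Matrix (Fin n) (Fin n) ℝ} {ρ : ℝ} (hρ : 0 < ρ) {n' : ℕ}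
    {v : Fin n' → EuclideanSpace ℝ (Fin n)} {t : Fin n' → Fin m} {i : Fin n' → Fin n}
    {α : Fin n' → ℝ} (h : IsDirectionSystem g N ρ v t i α) :
    (n' : ℝ) / 2 ≤ ((univ.image t).card : ℝ) := by
  have := card_le_mul_card_image (f := t) univ 2 (by
    intro a _
    obtain ⟨s, hs, hmem⟩ := (g a).isRotationOn_subset
    refine (card_le_card_of_injOn i (fun j hj => ?_) fun j hj j' hj' hij => ?_).trans hs
    · have hj : t j = a := by simpa using hj
      exact hmem _ (hj ▸ h.isRotationOn j)
    · have hj : t j = a := by simpa using hj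
      have hj' : t j' = a := by simpa using hj'
      exact h.eq_of_eq hρ (hj.trans hj'.symm) hij)
  rw [card_univ, Fintype.card_fin] at this
  have : (n' : ℝ) ≤ 2 * ((univ.image t).card : ℝ) := by exact_mod_cast this
  linarith

theorem IsDirectionSystem.card_le {g : Fin m → Gate n} {N : Fin m → Matrix (Fin n) (Fin n) ℝ}
    {ρ : ℝ} {n' : ℕ} {v : Fin n' → EuclideanSpace ℝ (Fin n)} {t : Fin n' → Fin m}
    {i : Fin n' → Fin n} {α : Fin n' → ℝ} (h : IsDirectionSystem g N ρ v t i α) : n' ≤ n := by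
  simpa using h.orthonormal.linearIndependent.fintype_card_le_finrank

theorem snoc_image_castSucc {β : Type*} {n' : ℕ} (v : Fin n' → β) (w : β) (j : Fin n') :
    (Fin.snoc v w : Fin (n' + 1) → β) '' {l | l < j.castSucc} = v '' {l | l < j} := by
  ext x
  constructor
  · rintro ⟨l, hl, rfl⟩
    refine ⟨⟨l, lt_trans hl j.2⟩, hl, ?_⟩
    exact (Fin.snoc_castSucc (α := fun _ => β) w v ⟨l, lt_trans hl j.2⟩).symm
  · rintro ⟨l, hl, rfl⟩
    exact ⟨l.castSucc, by simpa using hl, by simp⟩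

theorem snoc_image_last {β : Type*} {n' : ℕ} (v : Fin n' → β) (w : β) :
    (Fin.snoc v w : Fin (n' + 1) → β) '' {l | l < Fin.last n'} = Set.range v := by
  ext x
  constructor
  · rintro ⟨l, hl, rfl⟩
    exact ⟨⟨l, hl⟩, (Fin.snoc_castSucc (α := fun _ => β) w v ⟨l, hl⟩).symm⟩
  · rintro ⟨l, rfl⟩
    exact ⟨l.castSucc, Fin.castSucc_lt_last l, by simp⟩

theorem IsDirectionSystem.exists_snoc {g : Fin m → Gate n}
    {N : Fin m → Matrix (Fin n) (Fin n) ℝ} {ρ : ℝ} (hρ : 0 < ρ) {n' : ℕ}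
    {v : Fin n' → EuclideanSpace ℝ (Fin n)} {t : Fin n' → Fin m} {i : Fin n' → Fin n}
    {α : Fin n' → ℝ} (h : IsDirectionSystem g N ρ v t i α) {s : Fin m} {p : Fin n}
    (hp : (g s).IsRotationOn p)
    (hlt : ρ < ‖(Submodule.span ℝ (Set.range v))ᗮ.starProjection
      (WithLp.toLp 2 ((N s).row p))‖) :
    ∃ (v' : Fin (n' + 1) → EuclideanSpace ℝ (Fin n)) (t' : Fin (n' + 1) → Fin m)
      (i' : Fin (n' + 1) → Fin n) (α' : Fin (n' + 1) → ℝ), IsDirectionSystem g N ρ v' t' i' α' := by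
  set w := (Submodule.span ℝ (Set.range v))ᗮ.starProjection (WithLp.toLp 2 ((N s).row p)) with hw
  have hwmem : w ∈ (Submodule.span ℝ (Set.range v))ᗮ := Submodule.starProjection_apply_mem _ _
  have hpos : 0 < ‖w‖ := hρ.trans hlt
  have hinner : ∀ j, inner ℝ (v j) w = 0 := fun j =>
    hwmem _ (Submodule.subset_span ⟨j, rfl⟩)
  refine ⟨Fin.snoc v (‖w‖⁻¹ • w), Fin.snoc t s, Fin.snoc i p, Fin.snoc α ‖w‖, ⟨?_, ?_⟩, ?_, ?_, ?_⟩
  · intro j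
    refine Fin.lastCases ?_ (fun j => ?_) j
    · rw [Fin.snoc_last, norm_smul, norm_inv, norm_norm, inv_mul_cancel₀ hpos.ne']
    · rw [Fin.snoc_castSucc]; exact h.orthonormal.1 j
  · intro j j'
    refine Fin.lastCases ?_ (fun j => ?_) j <;> refine Fin.lastCases ?_ (fun j' => ?_) j'
    · exact fun hne => (hne rfl).elim
    · intro _
      rw [Fin.snoc_last, Fin.snoc_castSucc, real_inner_comm, inner_smul_right, hinner, mul_zero]
    · intro _
      rw [Fin.snoc_last, Fin.snoc_castSucc, inner_smul_right, hinner, mul_zero]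
    · intro hne
      rw [Fin.snoc_castSucc, Fin.snoc_castSucc]
      exact h.orthonormal.2 fun he => hne (by rw [he])
  · intro j
    refine Fin.lastCases ?_ (fun j => ?_) j
    · simp only [projAwayFromPrevious, snoc_image_last, Fin.snoc_last]
      rw [← hw, smul_smul, mul_inv_cancel₀ hpos.ne', one_smul]
    · simp only [projAwayFromPrevious, snoc_image_castSucc, Fin.snoc_castSucc]
      exact h.proj_eq j
  · intro j
    refine Fin.lastCases ?_ (fun j => ?_) j
    · rw [Fin.snoc_last]; exact hlt.le
    · rw [Fin.snoc_castSucc]; exact h.le_coeff j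
  · intro j
    refine Fin.lastCases ?_ (fun j => ?_) j
    · rw [Fin.snoc_last, Fin.snoc_last]; exact hp
    · rw [Fin.snoc_castSucc, Fin.snoc_castSucc]; exact h.isRotationOn j

theorem hasSevereDirections_or_exists_submodule (g : Fin m → Gate n)
    (N : Fin m → Matrix (Fin n) (Fin n) ℝ) {c₁ c₂ b : ℝ} (hρ : 0 < c₂ * √b) :
    HasSevereDirections g N c₁ c₂ b ∨
      ∃ S : Submodule ℝ (EuclideanSpace ℝ (Fin n)), (Module.finrank ℝ S : ℝ) ≤ c₁ * n ∧
        ∀ s p, (g s).IsRotationOn p →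
          ‖Sᗮ.starProjection (WithLp.toLp 2 ((N s).row p))‖ ≤ c₂ * √b := by
  classical
  let P : ℕ → Prop := fun n' => ∃ (v : Fin n' → EuclideanSpace ℝ (Fin n)) (t : Fin n' → Fin m)
    (i : Fin n' → Fin n) (α : Fin n' → ℝ), IsDirectionSystem g N (c₂ * √b) v t i α
  have hP0 : P 0 := ⟨Fin.elim0, Fin.elim0, Fin.elim0, Fin.elim0,
    ⟨fun j => j.elim0, fun j => j.elim0⟩, fun j => j.elim0, fun j => j.elim0, fun j => j.elim0⟩
  -- The search bound n loses nothing, since orthonormal systems have at most n members.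
  have hmax : ¬ P (Nat.findGreatest P n + 1) := by
    intro hc
    have hle : Nat.findGreatest P n + 1 ≤ n := by
      obtain ⟨v, t, i, α, h⟩ := hc
      exact h.card_le
    have := Nat.le_findGreatest hle hc
    omega
  obtain ⟨v, t, i, α, h⟩ : P (Nat.findGreatest P n) := Nat.findGreatest_spec (Nat.zero_le n) hP0
  by_cases hc : c₁ * (n : ℝ) ≤ (Nat.findGreatest P n : ℝ)
  · exact Or.inl ⟨_, hc, v, t, i, α, h.orthonormal, fun j => ⟨h.proj_eq j, h.le_coeff j⟩,
      h.isRotationOn, h.half_le_card_image hρ⟩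
  · refine Or.inr ⟨Submodule.span ℝ (Set.range v), ?_, fun s p hp => ?_⟩
    · have := finrank_range_le_card (R := ℝ) v
      rw [Fintype.card_fin] at this
      exact (Nat.cast_le.2 this).trans (not_le.1 hc).le
    · by_contra! hlt
      exact hmax (h.exists_snoc hρ hp hlt)

end Directions

/-! ### Small effect of projecting away low-dimensional subspaces. -/

section Projection

variable {n : ℕ}

theorem sum_norm_starProjection_sq (a : OrthonormalBasis (Fin n) ℝ (EuclideanSpace ℝ (Fin n)))
    (S : Submodule ℝ (EuclideanSpace ℝ (Fin n))) :
    ∑ i, ‖S.starProjection (a i)‖ ^ 2 = Module.finrank ℝ S := by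
  let e := stdOrthonormalBasis ℝ S
  have h : ∀ i, ‖S.starProjection (a i)‖ ^ 2
      = ∑ l, (inner ℝ (e l : EuclideanSpace ℝ (Fin n)) (a i)) ^ 2 := by
    intro i
    rw [Submodule.starProjection_apply, ← Submodule.coe_norm, ← e.sum_sq_inner_right]
    refine sum_congr rfl fun l _ => ?_
    rw [Submodule.inner_orthogonalProjectionOnto_eq_of_mem_left]
  rw [sum_congr rfl fun i _ => h i, sum_comm]
  simp_rw [a.sum_sq_inner_left]
  have : ∀ l, ‖(e l : EuclideanSpace ℝ (Fin n))‖ = 1 := fun l => e.orthonormal.1 l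
  simp [this]

/-- With e and f the components removed from u, (u - e)(u - f) - u² = -ue - uf + ef. Weighted AM-GM
with weight c bounds this by squares, and the squares of e and f sum to the dimensions of S and T,
at most c²n each. This is why the dimension bound is quadratic in c. -/
theorem sum_abs_starProjection_mul_sub_sq_le
    (a : OrthonormalBasis (Fin n) ℝ (EuclideanSpace ℝ (Fin n)))
    (S T : Submodule ℝ (EuclideanSpace ℝ (Fin n))) {c : ℝ} (hc : 0 < c) (hc1 : c ≤ 1)
    (hS : (Module.finrank ℝ S : ℝ) ≤ c ^ 2 * n) (hT : (Module.finrank ℝ T : ℝ) ≤ c ^ 2 * n) :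
    ∑ i, ∑ k, |Sᗮ.starProjection (a i) k * Tᗮ.starProjection (a i) k - a i k ^ 2| ≤ 3 * c * n := by
  have hn : (0 : ℝ) ≤ n := Nat.cast_nonneg n
  have pointwise : ∀ i k, |Sᗮ.starProjection (a i) k * Tᗮ.starProjection (a i) k - a i k ^ 2|
      ≤ c * a i k ^ 2 + (c⁻¹ + 1) / 2 * S.starProjection (a i) k ^ 2
        + (c⁻¹ + 1) / 2 * T.starProjection (a i) k ^ 2 := by
    intro i k
    set u := a i k
    set e := S.starProjection (a i) k
    set f := T.starProjection (a i) k
    have he : Sᗮ.starProjection (a i) k = u - e := by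
      rw [Submodule.starProjection_orthogonal_val]; rfl
    have hf : Tᗮ.starProjection (a i) k = u - f := by
      rw [Submodule.starProjection_orthogonal_val]; rfl
    rw [he, hf]
    have amgm : ∀ x : ℝ, |u * x| ≤ c / 2 * u ^ 2 + c⁻¹ / 2 * x ^ 2 := by
      intro x
      have h0 : ∀ y : ℝ, 0 ≤ c / 2 * u ^ 2 + c⁻¹ / 2 * y ^ 2 - u * y := by
        intro y
        have : c / 2 * u ^ 2 + c⁻¹ / 2 * y ^ 2 - u * y = c⁻¹ / 2 * (c * u - y) ^ 2 := by
          field_simp; ring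
        rw [this]; positivity
      have h1 := h0 x
      have h2 := h0 (-x)
      rw [abs_le]
      constructor <;> nlinarith
    have h1 := abs_le.1 (amgm e)
    have h2 := abs_le.1 (amgm f)
    have h3 := sq_nonneg (e - f)
    have h4 := sq_nonneg (e + f)
    rw [abs_le]
    constructor <;> nlinarith
  have hsum : ∀ x : Fin n → EuclideanSpace ℝ (Fin n), ∑ i, ∑ k, x i k ^ 2 = ∑ i, ‖x i‖ ^ 2 :=
    fun x => sum_congr rfl fun i _ => (EuclideanSpace.real_norm_sq_eq (x i)).symm
  have hS2 := sum_norm_starProjection_sq a S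
  have hT2 := sum_norm_starProjection_sq a T
  rw [← hsum] at hS2 hT2
  have ha : ∑ i, ∑ k, a i k ^ 2 = (n : ℝ) := by
    rw [hsum]; simp
  refine (sum_le_sum fun i _ => sum_le_sum fun k _ => pointwise i k).trans ?_
  simp only [sum_add_distrib, ← mul_sum]
  rw [hS2, hT2, ha]
  have hcc : (c⁻¹ + 1) / 2 * (c ^ 2 * n) ≤ c * n := by
    have : (c⁻¹ + 1) / 2 * (c ^ 2 * n) = (c + c ^ 2) / 2 * n := by field_simp
    rw [this]
    exact mul_le_mul_of_nonneg_right (by nlinarith) hn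
  have hpos : 0 ≤ (c⁻¹ + 1) / 2 := by positivity
  have h1 := mul_le_mul_of_nonneg_left hS hpos
  have h2 := mul_le_mul_of_nonneg_left hT hpos
  linarith

theorem abs_starProjection_apply_le_one (S : Submodule ℝ (EuclideanSpace ℝ (Fin n)))
    {x : EuclideanSpace ℝ (Fin n)} (hx : ‖x‖ = 1) (k : Fin n) : |S.starProjection x k| ≤ 1 := by
  rw [← Real.norm_eq_abs]
  exact (PiLp.norm_apply_le _ _).trans ((S.norm_starProjection_apply_le x).trans hx.le)

theorem abs_starProjection_mul_le_one (S T : Submodule ℝ (EuclideanSpace ℝ (Fin n)))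
    {x : EuclideanSpace ℝ (Fin n)} (hx : ‖x‖ = 1) (k : Fin n) :
    |S.starProjection x k * T.starProjection x k| ≤ 1 := by
  rw [abs_mul]
  exact mul_le_one₀ (abs_starProjection_apply_le_one S hx k) (abs_nonneg _)
    (abs_starProjection_apply_le_one T hx k)

end Projection

/-! ### Potential at the two ends of the computation. -/

section EntropyBounds

variable {n : ℕ} {S T : Submodule ℝ (EuclideanSpace ℝ (Fin n))} {c : ℝ}

theorem le_productEntropy_of_flat (a : OrthonormalBasis (Fin n) ℝ (EuclideanSpace ℝ (Fin n)))
    (ha : ∀ i k, a i k ^ 2 = 1 / (n : ℝ)) (hn : 1 ≤ n) (hc : 0 < c) (hc1 : c ≤ 1)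
    (hS : (Module.finrank ℝ S : ℝ) ≤ c ^ 2 * n) (hT : (Module.finrank ℝ T : ℝ) ≤ c ^ 2 * n) :
    n * Real.log n - 3 * c * n * (2 * Real.log n + 1) ≤
      productEntropy (fun i => Sᗮ.starProjection (a i)) fun i => Tᗮ.starProjection (a i) := by
  have hn1 : (1 : ℝ) ≤ n := by exact_mod_cast hn
  have hn0 : (0 : ℝ) < n := by linarith
  have hlog := Real.log_nonneg hn1
  have main := sum_abs_starProjection_mul_sub_sq_le a S T hc hc1 hS hT
  have pointwise : ∀ x : ℝ, |x| ≤ 1 →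
      1 / n * Real.log n - |x - 1 / n| * (2 * Real.log n + 1) ≤ Real.negMulLog x := by
    intro x hx
    -- Scaling by n moves the reference value 1 / n to 1, where z log z vanishes.
    have h1 := mul_log_le_abs_sub_one_mul (z := n * x) hn1
      (by rw [abs_mul, abs_of_pos hn0]; exact mul_le_of_le_one_right hn0.le hx)
    have h2 : (n * x) * Real.log (n * x) = n * (x * Real.log n - Real.negMulLog x) := by
      rcases eq_or_ne x 0 with rfl | h
      · simp
      · rw [Real.log_mul hn0.ne' h, Real.negMulLog]; ring
    have h3 : |n * x - 1| = n * |x - 1 / n| := by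
      rw [← abs_of_pos hn0, ← abs_mul, abs_of_pos hn0, mul_sub, mul_one_div_cancel hn0.ne']
    rw [h2, h3, mul_assoc] at h1
    have h4 := le_of_mul_le_mul_left h1 hn0
    have h5 := mul_le_mul_of_nonneg_right (neg_abs_le (x - 1 / n)) hlog
    linarith
  calc n * Real.log n - 3 * c * n * (2 * Real.log n + 1)
      ≤ n * Real.log n - (∑ i, ∑ k, |Sᗮ.starProjection (a i) k * Tᗮ.starProjection (a i) k
          - a i k ^ 2|) * (2 * Real.log n + 1) := by
        have := mul_le_mul_of_nonneg_right main (by linarith : 0 ≤ 2 * Real.log n + 1)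
        linarith
    _ = ∑ i, ∑ k, (1 / n * Real.log n - |Sᗮ.starProjection (a i) k * Tᗮ.starProjection (a i) k
          - 1 / n| * (2 * Real.log n + 1)) := by
        simp only [sum_sub_distrib, ← sum_mul, ha, sum_const, card_univ, Fintype.card_fin,
          nsmul_eq_mul]
        field_simp
    _ ≤ _ := sum_le_sum fun i _ => sum_le_sum fun k _ => pointwise _
        (abs_starProjection_mul_le_one _ _ (a.orthonormal.1 i) k)

theorem productEntropy_basisFun_le (hc : 0 < c) (hc1 : c ≤ 1)
    (hS : (Module.finrank ℝ S : ℝ) ≤ c ^ 2 * n) (hT : (Module.finrank ℝ T : ℝ) ≤ c ^ 2 * n)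
    {l : ℝ} (hl : 0 < l) (hlog : 1 ≤ Real.log l) :
    productEntropy (fun i => Sᗮ.starProjection (EuclideanSpace.basisFun (Fin n) ℝ i))
        (fun i => Tᗮ.starProjection (EuclideanSpace.basisFun (Fin n) ℝ i))
      ≤ 3 * c * n * Real.log l + (n : ℝ) ^ 2 / l := by
  set a := EuclideanSpace.basisFun (Fin n) ℝ with ha
  have main := sum_abs_starProjection_mul_sub_sq_le a S T hc hc1 hS hT
  have pointwise : ∀ i k, Real.negMulLog (Sᗮ.starProjection (a i) k * Tᗮ.starProjection (a i) k)
      ≤ |Sᗮ.starProjection (a i) k * Tᗮ.starProjection (a i) k - a i k ^ 2| * Real.log l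
        + 1 / l := by
    intro i k
    have hx := (abs_le.1 (abs_starProjection_mul_le_one Sᗮ Tᗮ (a.orthonormal.1 i) k)).1
    by_cases hik : k = i
    · have : a i k ^ 2 = 1 := by simp [ha, hik]
      rw [this]
      exact negMulLog_le_abs_sub_one_mul_log hx hl hlog
    · have : a i k ^ 2 = 0 := by simp [ha, hik]
      rw [this, sub_zero]
      exact negMulLog_le_abs_mul_log hx hl hlog
  refine (sum_le_sum fun i _ => sum_le_sum fun k _ => pointwise i k).trans ?_
  simp only [sum_add_distrib, ← sum_mul, sum_const, card_univ, Fintype.card_fin, nsmul_eq_mul]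
  have h1 := mul_le_mul_of_nonneg_right main (by linarith : 0 ≤ Real.log l)
  have h2 : (n : ℝ) * (n * (1 / l)) = (n : ℝ) ^ 2 / l := by ring
  linarith

/-- The rows of the Walsh-Hadamard matrix as an orthonormal basis. -/
noncomputable def walshBasis (k : ℕ) :
    OrthonormalBasis (Fin (2 ^ k)) ℝ (EuclideanSpace ℝ (Fin (2 ^ k))) :=
  have hon : Orthonormal ℝ fun p => WithLp.toLp 2 ((walshHadamard (2 ^ k)).row p) := by
    rw [orthonormal_iff_ite]
    intro p p'
    rw [← walshHadamard_row_inner, EuclideanSpace.inner_eq_star_dotProduct]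
    exact sum_congr rfl fun q _ => mul_comm _ _
  OrthonormalBasis.mk hon (by
    rw [hon.linearIndependent.span_eq_top_of_card_eq_finrank' (by simp)])

theorem walshBasis_apply (k : ℕ) (p : Fin (2 ^ k)) :
    walshBasis k p = WithLp.toLp 2 ((walshHadamard (2 ^ k)).row p) := by
  rw [walshBasis, OrthonormalBasis.coe_mk]

theorem productEntropy_walsh_gap {k : ℕ} (hk : 1 ≤ k)
    {S T : Submodule ℝ (EuclideanSpace ℝ (Fin (2 ^ k)))}
    (hS : (Module.finrank ℝ S : ℝ) ≤ (1 / 1000) ^ 2 * (2 ^ k : ℕ))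
    (hT : (Module.finrank ℝ T : ℝ) ≤ (1 / 1000) ^ 2 * (2 ^ k : ℕ)) :
    productEntropy (fun i => Sᗮ.starProjection (EuclideanSpace.basisFun (Fin (2 ^ k)) ℝ i))
        (fun i => Tᗮ.starProjection (EuclideanSpace.basisFun (Fin (2 ^ k)) ℝ i))
      + (2 ^ k : ℕ) * Real.log (2 ^ k : ℕ) / 2
      ≤ productEntropy (fun i => Sᗮ.starProjection (walshBasis k i))
        fun i => Tᗮ.starProjection (walshBasis k i) := by
  have hn : (2 : ℝ) ≤ (2 ^ k : ℕ) := by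
    exact_mod_cast Nat.pow_le_pow_right (n := 2) (by norm_num) hk
  have lower := le_productEntropy_of_flat (walshBasis k)
    (fun i q => by rw [walshBasis_apply]; exact walshHadamard_sq i q) Nat.one_le_two_pow
    (by norm_num) (by norm_num) hS hT
  set N : ℝ := ((2 ^ k : ℕ) : ℝ) with hN
  have hlogN : Real.log 2 ≤ Real.log N := Real.log_le_log (by norm_num) hn
  have h2 := Real.log_two_gt_d9
  have hl : Real.log (16 * N ^ 2) = 4 * Real.log 2 + 2 * Real.log N := by
    rw [Real.log_mul (by norm_num) (by positivity), Real.log_pow,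
      (by norm_num : (16 : ℝ) = 2 ^ 4), Real.log_pow]
    norm_num
  -- With l = 16 N² the N² additive errors sum to 1/16, small against N log N even for N = 2.
  have upper := productEntropy_basisFun_le (by norm_num) (by norm_num) hS hT
    (l := 16 * N ^ 2) (by positivity) (by rw [hl]; linarith)
  have hq : N ^ 2 / (16 * N ^ 2) = 1 / 16 := by field_simp
  rw [← hN, hl, hq] at upper
  have h3 : N * (69 / 100) ≤ N * Real.log N := mul_le_mul_of_nonneg_left (by linarith) (by linarith)
  have h4 : N * Real.log 2 ≤ N * Real.log N := mul_le_mul_of_nonneg_left hlogN (by linarith)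
  linarith

end EntropyBounds

/-! ### Growth of the projected potential along the algorithm. -/

section Evolution

variable {n m : ℕ}

theorem productEntropy_stateMatrix_le (g : Fin m → Gate n)
    (S T : Submodule ℝ (EuclideanSpace ℝ (Fin n))) {ρ : ℝ}
    (hS : ∀ s p, (g s).IsRotationOn p →
      ‖S.starProjection (WithLp.toLp 2 ((stateMatrix g s.succ).row p))‖ ≤ ρ)
    (hT : ∀ s p, (g s).IsRotationOn p →
      ‖T.starProjection (WithLp.toLp 2 ((((stateMatrix g s.succ)⁻¹).transpose).row p))‖ ≤ ρ)
    (t : Fin (m + 1)) :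
    productEntropy (fun i => S.starProjection (WithLp.toLp 2 ((stateMatrix g t).row i)))
        (fun i => T.starProjection (WithLp.toLp 2 ((((stateMatrix g t)⁻¹).transpose).row i)))
      ≤ productEntropy (fun i => S.starProjection (EuclideanSpace.basisFun (Fin n) ℝ i))
        (fun i => T.starProjection (EuclideanSpace.basisFun (Fin n) ℝ i))
        + 8 * ρ ^ 2 * (t : ℕ) := by
  have rows : ∀ (U : Submodule ℝ (EuclideanSpace ℝ (Fin n))) (h : Gate n)
      (M : Matrix (Fin n) (Fin n) ℝ),
      (fun i => U.starProjection (WithLp.toLp 2 ((h.matrix * M).row i)))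
        = h.act fun i => U.starProjection (WithLp.toLp 2 (M.row i)) := by
    intro U h M
    ext1 i
    rw [Gate.row_matrix_mul]
    exact Gate.map_act (U.starProjection.toLinearMap ∘ₗ
      (WithLp.linearEquiv 2 ℝ (Fin n → ℝ)).symm.toLinearMap) h M.row i
  induction t using Fin.induction with
  | zero =>
    have h1 : ∀ i, WithLp.toLp 2 ((1 : Matrix (Fin n) (Fin n) ℝ).row i)
        = EuclideanSpace.basisFun (Fin n) ℝ i := by
      intro i
      ext k
      simp [Matrix.one_apply, eq_comm]
    rw [stateMatrix_zero, inv_one, Matrix.transpose_one]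
    simp [h1]
  | succ s ih =>
    have hS' := hS s
    have hT' := hT s
    rw [stateMatrix_succ_inv_transpose] at hT' ⊢
    rw [stateMatrix_succ] at hS' ⊢
    rw [rows, rows]
    have := productEntropy_act_le (g s) _ _
      (fun p hp => (congrArg norm (congrFun (rows S _ _) p)).symm.trans_le (hS' p hp))
      (fun p hp => (congrArg norm (congrFun (rows T _ _) p)).symm.trans_le (hT' p hp))
    rw [Fin.val_castSucc] at ih
    rw [Fin.val_succ]
    push_cast
    linarith

end Evolution

theorem theorem2 :
    ∃ c₁ : ℝ, 0 < c₁ ∧ ∃ c₂ : ℝ, 0 < c₂ ∧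
      ∀ (n k : ℕ), 1 ≤ k → n = 2 ^ k →
      ∀ (m : ℕ) (b : ℝ), 1 ≤ b → (m : ℝ) = ((n : ℝ) * Real.logb 2 (n : ℝ)) / b →
      ∀ g : Fin m → Gate n, stateMatrix g (Fin.last m) = walshHadamard n →
        SevereOverflow g c₁ c₂ b ∨ SevereUnderflow g c₁ c₂ b := by

  -- c₁ is c² for c = 1/1000 in the projection estimates. With c₂ = 1/8 a step adds at most 8 c₂² b
  -- = b / 8.
  refine ⟨(1 / 1000) ^ 2, by norm_num, 1 / 8, by norm_num, ?_⟩
  rintro n k hk rfl m b hb hm g hg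
  have hb0 : 0 < b := by linarith
  have hρ : 0 < 1 / 8 * √b := by positivity
  rcases hasSevereDirections_or_exists_submodule g (fun t => stateMatrix g t.succ)
    (c₁ := (1 / 1000) ^ 2) hρ with h | ⟨S, hS, hSρ⟩
  · exact Or.inl h
  rcases hasSevereDirections_or_exists_submodule g
    (fun t => ((stateMatrix g t.succ)⁻¹).transpose) (c₁ := (1 / 1000) ^ 2) hρ with h | ⟨T, hT, hTρ⟩
  · exact Or.inr h
  exfalso
  have growth := productEntropy_stateMatrix_le g Sᗮ Tᗮ hSρ hTρ (Fin.last m)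
  rw [hg, walshHadamard_inv_transpose, Fin.val_last, mul_pow, Real.sq_sqrt hb0.le, hm] at growth
  have gap := productEntropy_walsh_gap hk hS hT
  simp only [walshBasis_apply] at gap
  have hN : (2 : ℝ) ≤ (2 ^ k : ℕ) := by
    exact_mod_cast Nat.pow_le_pow_right (n := 2) (by norm_num) hk
  set N : ℝ := ((2 ^ k : ℕ) : ℝ)
  have h2 := Real.log_two_gt_d9
  have hlogb : Real.log N = Real.log 2 * Real.logb 2 N := by
    rw [Real.logb]; field_simp
  have hsteps : 8 * ((1 / 8) ^ 2 * b) * (N * Real.logb 2 N / b) = N * Real.logb 2 N / 8 := by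
    field_simp
  have hpos : 0 < N * Real.logb 2 N :=
    mul_pos (by linarith) (Real.logb_pos (by norm_num) (by linarith))
  rw [hsteps] at growth
  rw [hlogb] at gap
  -- Growth of at most (1/8) N log₂ N contradicts a gap of at least (log 2 / 2) N log₂ N, as log 2 >
  -- 1/4.
  nlinarith
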